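/- Let $I=[a,b]$, let $k\ge 0$ and let $f=f_1\times\dots\times f_k:I^k\to I^k$ be the product of maps $f_s:I\to I$ (for example of expansive Markov maps). Let $\tilde\mu$ be an $f$-invariant Borel probability measure on $I^k$. Let $M$ be an irreducible $q\times q$ matrix with entries in $\{0,1\}$, let $\Sigma_M$ be the set of sequences $x_0x_1\dots\in\{0,\dots,q-1\}^{\mathbb N}$ with $M_{x_ix_{i+1}}=1$ for all $i\ge 0$, and let $\sigma$ be the left shift. For a word $w$, let $C_w\subseteq\Sigma_M$ be the cylinder of the sequences in $\Sigma_M$ that start with $w$. Let $\mu$ be the Parry measure on $\Sigma_M$, that is, the measure with $$\mu(C_{i_1\dots i_m})=\frac{u_{i_1}v_{i_m}}{\lambda^{m-1}}\,M_{i_1i_2}\cdots M_{i_{m-1}i_m}\qquad\text{for all words } i_1\dots i_m,\ m\ge 1,$$ where $\lambda$ is the largest real eigenvalue of $M$ and $u$, $v$ are positive left and right eigenvectors of $M$ for $\lambda$ with $uv=1$. Suppose that $(I^k,\tilde\mu,f)$ and $(\Sigma_M,\mu,\sigma)$ are metrically conjugate: there are measurable sets $A_1\subseteq I^k$ and $A_2\subseteq\Sigma_M$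 of full measure with $f(A_1)\subseteq A_1$ and $\sigma(A_2)\subseteq A_2$, and an invertible measure-preserving map $\psi:A_2\to A_1$ (measurable with measurable inverse) with $\psi\circ\sigma=f\circ\psi$ on $A_2$. Let $n\ge 2$, let $\mathcal F$ be the collection of all words of length $n$ over $\{0,\dots,q-1\}$ that appear in no sequence of $\Sigma_M$ (so $\Sigma_{\mathcal F}=\Sigma_M$), and let $\mathcal F_1$ be any collection of words of length $n$. For a collection $\mathcal G$ of words, $\Sigma_{\mathcal G}$ denotes the set of all sequences in $\{0,\dots,q-1\}^{\mathbb N}$ in which no word of $\mathcal G$ appears, and $h_{\mathrm{top}}(\Sigma_{\mathcal G})$ is the topological entropy of the shift on it. Let the hole $H\subseteq I^k$ be a Borel set that corresponds to $\bigcup_{w\in\mathcal F_1}C_w$ under the conjugacy, that is, for $\mu$-almost every $x\in A_2$ one has $\psi(x)\in H$ if and only if $x\in\bigcup_{w\in\mathcal F_1}C_w$. Put $\Omega_m(H)=\bigcup_{j=0}^{m}f^{-j}(H)$. Then the escape rate $$\rho(H)=-\lim_{m\to\infty}\frac1m\ln\tilde\mu\bigl(I^k\setminus\Omega_m(H)\bigr)$$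 exists and $$\rho(H)=h_{\mathrm{top}}(\Sigma_{\mathcal F})-h_{\mathrm{top}}(\Sigma_{\mathcal F\cup\mathcal F_1}).$$ Here $\ln 0=-\infty$ and $h_{\mathrm{top}}(\emptyset)=-\infty$, so that both sides are $+\infty$ if $\Sigma_{\mathcal F\cup\mathcal F_1}=\emptyset$. -/

import Mathlib

open MeasureTheory Set Filter Topology

noncomputable section

namespace EscapeRate

/-! ### Escape rate into a hole -/

/-- `Ω_m(A)`: the points `x` with `T^j x ∈ A` for some `0 ≤ j ≤ m`. -/
def escaped {X : Type*} (T : X → X) (A : Set X) (m : ℕ) : Set X :=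
  {x | ∃ j ≤ m, T^[j] x ∈ A}

/-- The escape rate `-lim (1/m) ln μ(X ∖ Ω_m(A))` exists and equals `ρ`. Values are extended reals,
with `ln 0 = -∞`. -/
def HasEscapeRate {X : Type*} [MeasurableSpace X] (μ : Measure X) (T : X → X) (A : Set X)
    (ρ : EReal) : Prop :=
  Tendsto (fun m : ℕ => -(ENNReal.log (μ (escaped T A m)ᶜ) / (m : EReal))) atTop (𝓝 ρ)

/-! ### Metric conjugacy -/

/-- A metric conjugacy from `(X₂, μ₂, T₂)` to `(X₁, μ₁, T₁)`: forward invariant measurable sets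
`A₁`, `A₂` of full measure and an invertible measure preserving map `ψ : A₂ → A₁` (measurable with
measurable inverse) such that `ψ ∘ T₂ = T₁ ∘ ψ` on `A₂`. -/
structure MetricConjugacy {X₁ X₂ : Type*} [MeasurableSpace X₁] [MeasurableSpace X₂]
    (μ₁ : Measure X₁) (T₁ : X₁ → X₁) (μ₂ : Measure X₂) (T₂ : X₂ → X₂) where
  A₁ : Set X₁
  A₂ : Set X₂
  measurableSet₁ : MeasurableSet A₁
  measurableSet₂ : MeasurableSet A₂
  full₁ : μ₁ A₁ = 1
  full₂ : μ₂ A₂ = 1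
  mapsTo₁ : MapsTo T₁ A₁ A₁
  mapsTo₂ : MapsTo T₂ A₂ A₂
  ψ : A₂ ≃ᵐ A₁
  measurePreserving : MeasurePreserving ψ
    (μ₂.comap (Subtype.val : A₂ → X₂)) (μ₁.comap (Subtype.val : A₁ → X₁))
  comm : ∀ x : A₂, (ψ ⟨T₂ x, mapsTo₂ x.2⟩ : X₁) = T₁ (ψ x)

/-- Under the conjugacy the set `H ⊆ X₁` corresponds to the set `E ⊆ X₂`, up to a null set. -/
def MetricConjugacy.Corresponds {X₁ X₂ : Type*} [MeasurableSpace X₁] [MeasurableSpace X₂]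
    {μ₁ : Measure X₁} {T₁ : X₁ → X₁} {μ₂ : Measure X₂} {T₂ : X₂ → X₂}
    (c : MetricConjugacy μ₁ T₁ μ₂ T₂) (H : Set X₁) (E : Set X₂) : Prop :=
  ∀ᵐ x ∂μ₂, ∀ hx : x ∈ c.A₂, ((c.ψ ⟨x, hx⟩ : X₁) ∈ H ↔ x ∈ E)

/-! ### Shift spaces -/

/-- The left shift on one-sided sequences with symbols `0, …, q - 1`. -/
def shift {q : ℕ} (x : ℕ → Fin q) : ℕ → Fin q := fun i => x (i + 1)

/-- The word `w` appears in the sequence `x` at position `i`. -/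
def AppearsAt {q n : ℕ} (w : Fin n → Fin q) (x : ℕ → Fin q) (i : ℕ) : Prop :=
  ∀ j : Fin n, x (i + j) = w j

/-- `Σ_M`: the sequences that are admissible for the transition matrix `M`. -/
def transitionShift {q : ℕ} (M : Matrix (Fin q) (Fin q) ℝ) : Set (ℕ → Fin q) :=
  {x | ∀ i, M (x i) (x (i + 1)) = 1}

/-- The left shift as a self-map of `Σ_M`. -/
def shiftOn {q : ℕ} (M : Matrix (Fin q) (Fin q) ℝ) (x : transitionShift M) : transitionShift M :=
  ⟨shift x, fun i => x.2 (i + 1)⟩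

/-- The cylinder `C_w ⊆ Σ_M` of the sequences in `Σ_M` that start with `w`. -/
def cylinder {q n : ℕ} (M : Matrix (Fin q) (Fin q) ℝ) (w : Fin n → Fin q) :
    Set (transitionShift M) :=
  {x | AppearsAt w x 0}

/-- `Σ_F`: the sequences in which no word of the collection `F` appears. -/
def avoidingShift {q n : ℕ} (F : Set (Fin n → Fin q)) : Set (ℕ → Fin q) :=
  {x | ∀ w ∈ F, ∀ i, ¬ AppearsAt w x i}

/-- The collection of all words of length `n` that appear in no sequence of `Σ_M`. -/
def forbiddenWords {q : ℕ} (M : Matrix (Fin q) (Fin q) ℝ) (n : ℕ) : Set (Fin n → Fin q) :=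
  {w | ∀ x ∈ transitionShift M, ∀ i, ¬ AppearsAt w x i}

/-- Topological entropy of a shift space `S`, for the product uniformity of the discrete one on
symbols. It is `-∞` for `S = ∅`. -/
def topEntropy {q : ℕ} (S : Set (ℕ → Fin q)) : EReal :=
  @Dynamics.coverEntropy (ℕ → Fin q) (@Pi.uniformSpace ℕ (fun _ => Fin q) (fun _ => ⊥)) shift S

/-! ### The Parry measure -/

/-- `l` is the largest real eigenvalue of `M`, and `u`, `v` are positive left and right
eigenvectors for `l`, normalized by `u v = 1`. -/
structure IsPerronTriple {q : ℕ} (M : Matrix (Fin q) (Fin q) ℝ) (l : ℝ) (u v : Fin q → ℝ) :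
    Prop where
  isGreatest : IsGreatest {t : ℝ | Module.End.HasEigenvalue (Matrix.toLin' M) t} l
  left : Matrix.vecMul u M = l • u
  right : Matrix.mulVec M v = l • v
  left_pos : ∀ i, 0 < u i
  right_pos : ∀ i, 0 < v i
  normalized : u ⬝ᵥ v = 1

/-- `μ` is the Parry measure on `Σ_M`: the Markov measure with
`μ(C_w) = u_{w_0} v_{w_m} / l ^ m * M_{w_0 w_1} ⋯ M_{w_{m-1} w_m}` for all words
`w = w_0 w_1 … w_m`. Cylinders generate the measurable sets, so `μ` is unique. -/
def IsParryMeasure {q : ℕ} (M : Matrix (Fin q) (Fin q) ℝ) (μ : Measure (transitionShift M)) :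
    Prop :=
  ∃ (l : ℝ) (u v : Fin q → ℝ), IsPerronTriple M l u v ∧
    ∀ (m : ℕ) (w : Fin (m + 1) → Fin q),
      μ (cylinder M w) = ENNReal.ofReal
        (u (w 0) * v (w (Fin.last m)) / l ^ m * ∏ i : Fin m, M (w i.castSucc) (w i.succ))

end EscapeRate

end

namespace EscapeRate

/-! ### Words of a set of sequences -/

/-! The Parry measure is uniform up to constants: each cylinder of an admissible word of length `m +
1` has measure between `c / l ^ m` and `C / l ^ m`. So the measure of a set fixed by its first `m +
1` letters is comparable to its number of words divided by `l ^ m` (`IsParryMeasure.exists_bounds`).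
For the whole space this gives entropy `log l`. For the survivors the growth rate of the words is
needed.

Every word of the avoiding shift survives. Conversely, a surviving word need not extend to an
avoiding sequence, but by compactness it does after deleting a bounded number `K` of final letters
(`exists_forall_avoiding_extension`). Hence the two counts differ at most by the factor `q ^ K`,
which does not affect the growth rate, and this rate is the entropy (`topEntropy_eq_of_tendsto`).
The conjugacy carries survivor measures over to the hole `H`
(`MetricConjugacy.measure_compl_escaped`). -/

theorem shift_iterate_apply {q : ℕ} (x : ℕ → Fin q) (m i : ℕ) : shift^[m] x i = x (i + m) := by
  induction m generalizing x with
  | zero => rfl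
  | succ m ih => rw [Function.iterate_succ_apply, ih]; rfl

/-- The words of length `m` that are initial segments of sequences in `A`. -/
def prefixes {q : ℕ} (A : Set (ℕ → Fin q)) (m : ℕ) : Set (Fin m → Fin q) :=
  (fun x (i : Fin m) => x i) '' A

/-- The number of words of length `m` that are initial segments of sequences in `A`. -/
noncomputable def wordCount {q : ℕ} (A : Set (ℕ → Fin q)) (m : ℕ) : ℕ :=
  (prefixes A m).ncard

theorem wordCount_pos {q : ℕ} {A : Set (ℕ → Fin q)} (hA : A.Nonempty) (m : ℕ) :
    0 < wordCount A m :=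
  (Set.ncard_pos (Set.toFinite _)).2 (hA.image _)

theorem wordCount_le_of_forall {q : ℕ} {A B : Set (ℕ → Fin q)} {m : ℕ}
    (h : ∀ x ∈ A, ∃ y ∈ B, ∀ i < m, y i = x i) : wordCount A m ≤ wordCount B m := by
  refine Set.ncard_le_ncard ?_ (Set.toFinite _)
  rintro _ ⟨x, hx, rfl⟩
  obtain ⟨y, hy, hyx⟩ := h x hx
  exact ⟨y, hy, funext fun i => hyx i i.2⟩

theorem wordCount_le_wordCount_add {q : ℕ} (A : Set (ℕ → Fin q)) (m j : ℕ) :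
    wordCount A m ≤ wordCount A (m + j) := by
  have : prefixes A m = (fun w (i : Fin m) => w (i.castAdd j)) '' prefixes A (m + j) := by
    simp only [prefixes, Set.image_image]
    rfl
  rw [wordCount, this]
  exact Set.ncard_image_le (Set.toFinite _)

/-- Cutting a word after `m` letters is injective. `A` need not be shift invariant, since the sets
of survivors are not. -/
theorem wordCount_add_le {q : ℕ} (A : Set (ℕ → Fin q)) (m j : ℕ) :
    wordCount A (m + j) ≤ wordCount A m * wordCount (shift^[m] '' A) j := by
  rw [wordCount, wordCount, wordCount, ← Set.ncard_prod]
  refine Set.ncard_le_ncard_of_injOn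
    (fun w => (fun i : Fin m => w (i.castAdd j), fun i : Fin j => w (i.natAdd m))) ?_ ?_
    (Set.toFinite _)
  · rintro _ ⟨x, hx, rfl⟩
    refine ⟨⟨x, hx, rfl⟩, ⟨shift^[m] x, ⟨x, hx, rfl⟩, ?_⟩⟩
    funext i
    simp [shift_iterate_apply, add_comm]
  · intro w _ w' _ h
    simp only [Prod.mk.injEq] at h
    funext i
    refine Fin.addCases (fun i => congrFun h.1 i) (fun i => congrFun h.2 i) i

theorem wordCount_le_pow {q : ℕ} (A : Set (ℕ → Fin q)) (m : ℕ) : wordCount A m ≤ q ^ m := by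
  refine (Set.ncard_le_ncard (Set.subset_univ _) (Set.toFinite _)).trans ?_
  simp [Set.ncard_univ]

theorem wordCount_add_le_of_mapsTo {q : ℕ} {A : Set (ℕ → Fin q)} (hA : MapsTo shift A A)
    (m j : ℕ) : wordCount A (m + j) ≤ wordCount A m * wordCount A j := by
  refine (wordCount_add_le A m j).trans (Nat.mul_le_mul_left _ (wordCount_le_of_forall ?_))
  rintro _ ⟨x, hx, rfl⟩
  exact ⟨_, hA.iterate m hx, fun _ _ => rfl⟩

theorem wordCount_add_le_mul_pow {q : ℕ} (A : Set (ℕ → Fin q)) (m j : ℕ) :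
    wordCount A (m + j) ≤ wordCount A m * q ^ j :=
  (wordCount_add_le A m j).trans (Nat.mul_le_mul_left _ (wordCount_le_pow _ _))

/-! ### Entropy is the growth rate of the number of words -/

/-- The pairs of sequences that agree in the first `r` places. -/
def agreement (q r : ℕ) : SetRel (ℕ → Fin q) (ℕ → Fin q) := {p | ∀ i < r, p.1 i = p.2 i}

theorem hasBasis_agreement (q : ℕ) :
    (@uniformity (ℕ → Fin q) (@Pi.uniformSpace ℕ (fun _ => Fin q) (fun _ => ⊥))).HasBasis
      (fun r => 1 ≤ r) (agreement q) := by
  let _ : UniformSpace (Fin q) := ⊥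
  refine ⟨fun t => ?_⟩
  constructor
  · intro ht
    rw [Pi.uniformity, Filter.mem_iInf] at ht
    obtain ⟨I, hI, V, hV, rfl⟩ := ht
    obtain ⟨r, hr⟩ := hI.bddAbove
    refine ⟨r + 1, by omega, fun p hp => Set.mem_iInter.2 fun i => ?_⟩
    obtain ⟨W, hW, hWV⟩ := Filter.mem_comap.1 (hV i)
    apply hWV
    have hWid : SetRel.id ⊆ W := by simpa using refl_le_uniformity hW
    exact hWid (hp i (Nat.lt_succ_of_le (hr i.2)))
  · rintro ⟨r, -, hr⟩
    refine Filter.mem_of_superset ?_ hr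
    have : agreement q r = ⋂ i ∈ Finset.range r, {p | p.1 i = p.2 i} := by
      ext p; simp [agreement]
    rw [this, Filter.biInter_finset_mem]
    intro i _
    rw [Pi.uniformity]
    refine Filter.mem_iInf_of_mem i (Filter.mem_comap.2 ⟨SetRel.id, ?_, fun p hp => hp⟩)
    exact Filter.mem_principal_self _

theorem mem_dynEntourage_agreement {q r m : ℕ} (hr : 1 ≤ r) {x y : ℕ → Fin q} :
    (x, y) ∈ Dynamics.dynEntourage shift (agreement q r) m ↔
      m = 0 ∨ ∀ i < m + (r - 1), x i = y i := by
  rw [Dynamics.mem_dynEntourage]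
  simp only [agreement, Set.mem_ofPred_eq, shift_iterate_apply]
  constructor
  · intro h
    rcases Nat.eq_zero_or_pos m with hm | hm
    · exact Or.inl hm
    · refine Or.inr fun i hi => ?_
      by_cases him : i < m
      · simpa using h i him 0 (by omega)
      · simpa [show i - (m - 1) + (m - 1) = i by omega] using
          h (m - 1) (by omega) (i - (m - 1)) (by omega)
  · rintro (rfl | h) j hj i hi
    · omega
    · exact h _ (by omega)

/-- Dynamical balls are cylinders of length `m + (r - 1)`, so a minimal cover takes one point per
word. For `m = 0` the dynamical entourage is everything and the count fails. -/
theorem coverMincard_agreement {q r m : ℕ} (hr : 1 ≤ r) (hm : m ≠ 0) (S : Set (ℕ → Fin q)) :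
    Dynamics.coverMincard shift S (agreement q r) m = wordCount S (m + (r - 1)) := by
  classical
  apply le_antisymm
  · obtain ⟨t, htS, ht⟩ : ∃ t : Set (ℕ → Fin q), t ⊆ S ∧
        BijOn (fun x (i : Fin (m + (r - 1))) => x i) t (prefixes S (m + (r - 1))) :=
      (surjOn_image _ S).exists_bijOn_subset
    have htfin : t.Finite := ht.finite_iff_finite.2 (Set.toFinite _)
    have hcard : wordCount S (m + (r - 1)) = htfin.toFinset.card := by
      rw [wordCount, ← ht.image_eq, ht.injOn.ncard_image,
        Set.ncard_eq_toFinset_card _ htfin]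
    rw [hcard]
    refine Dynamics.IsDynCoverOf.coverMincard_le_card ?_
    intro x hx
    obtain ⟨y, hy, hyx⟩ := ht.surjOn ⟨x, hx, rfl⟩
    refine ⟨y, by simpa using hy, (mem_dynEntourage_agreement hr).2 (Or.inr fun i hi => ?_)⟩
    exact (congrFun hyx ⟨i, hi⟩).symm
  · refine le_iInf₂ fun s hs => ?_
    have : prefixes S (m + (r - 1)) ⊆ (s.image fun x (i : Fin (m + (r - 1))) => x i : Finset _) := by
      rintro _ ⟨x, hx, rfl⟩
      obtain ⟨y, hy, hxy⟩ := hs hx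
      have hxy := ((mem_dynEntourage_agreement hr).1 hxy).resolve_left hm
      rw [Finset.coe_image]
      exact ⟨y, hy, funext fun i => (hxy i i.2).symm⟩
    have := (Set.ncard_le_ncard this (Set.toFinite _)).trans_eq (Set.ncard_coe_finset _)
    exact_mod_cast this.trans Finset.card_image_le

/-- Fekete's lemma: invariance makes the logarithm of the word count subadditive. -/
theorem exists_tendsto_log_wordCount {q : ℕ} {S : Set (ℕ → Fin q)} (hS : S.Nonempty)
    (hinv : MapsTo shift S S) :
    ∃ L : ℝ, Tendsto (fun m : ℕ => Real.log (wordCount S m) / m) atTop (𝓝 L) := by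
  have hsub : Subadditive fun m => Real.log (wordCount S m) := by
    intro m j
    have hm := wordCount_pos hS m
    have hj := wordCount_pos hS j
    rw [← Real.log_mul (by positivity) (by positivity)]
    refine Real.log_le_log (by exact_mod_cast wordCount_pos hS _) ?_
    exact_mod_cast wordCount_add_le_of_mapsTo hinv m j
  refine ⟨hsub.lim, hsub.tendsto_lim ⟨0, ?_⟩⟩
  rintro _ ⟨m, rfl⟩
  exact div_nonneg (Real.log_natCast_nonneg _) (Nat.cast_nonneg _)

theorem tendsto_div_shift {a : ℕ → ℝ} {L : ℝ} (h : Tendsto (fun m : ℕ => a m / m) atTop (𝓝 L))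
    (p : ℕ) : Tendsto (fun m : ℕ => a (m + p) / m) atTop (𝓝 L) := by
  have h1 := h.comp (tendsto_add_atTop_nat p)
  have h2 : Tendsto (fun m : ℕ => ((m + p : ℕ) : ℝ) / m) atTop (𝓝 1) := by
    have := (tendsto_const_nhds (x := (1 : ℝ))).add
      (tendsto_const_div_atTop_nhds_zero_nat (p : ℝ))
    rw [add_zero] at this
    refine this.congr' ?_
    filter_upwards [eventually_gt_atTop 0] with m hm
    push_cast
    field_simp
  have h3 := h1.mul h2
  rw [mul_one] at h3
  refine h3.congr' ?_
  filter_upwards [eventually_gt_atTop 0] with m hm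
  have : ((m + p : ℕ) : ℝ) ≠ 0 := by positivity
  simp only [Function.comp]
  field_simp

/-- Every scale `r` gives the same rate, because lengthening words by the constant `r - 1` does not
change the limit. -/
theorem topEntropy_eq_of_tendsto {q : ℕ} {S : Set (ℕ → Fin q)} (hS : S.Nonempty) {L : ℝ}
    (hL : Tendsto (fun m : ℕ => Real.log (wordCount S m) / m) atTop (𝓝 L)) :
    topEntropy S = L := by
  have key : ∀ r, 1 ≤ r → Dynamics.coverEntropyEntourage shift S (agreement q r) = L := by
    intro r hr
    refine Tendsto.limsup_eq ?_
    refine ((continuous_coe_real_ereal.tendsto L).comp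
      (tendsto_div_shift (a := fun m => Real.log (wordCount S m)) hL (r - 1))).congr' ?_
    filter_upwards [eventually_gt_atTop 0] with m hm
    have hpos := wordCount_pos hS (m + (r - 1))
    rw [coverMincard_agreement hr hm.ne' S]
    have : ENNReal.log ((wordCount S (m + (r - 1)) : ℕ∞) : ENNReal) =
        (Real.log (wordCount S (m + (r - 1))) : ℝ) := by
      rw [ENat.toENNReal_coe, ENNReal.log_pos_real (by simpa using hpos.ne') (by simp)]
      simp
    rw [this]
    simp only [Function.comp]
    rw [EReal.coe_div]
    simp
  let _ : UniformSpace (Fin q) := ⊥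
  rw [topEntropy, Dynamics.coverEntropy_eq_iSup_basis (hasBasis_agreement q)]
  apply le_antisymm
  · exact iSup₂_le fun r hr => (key r hr).le
  · exact (key 1 le_rfl).ge.trans (le_iSup₂ (f := fun r (_ : 1 ≤ r) =>
      Dynamics.coverEntropyEntourage shift S (agreement q r)) 1 le_rfl)

/-! ### Extending words that avoid a finite collection of words -/

theorem isClopen_setOf_prefix {q n : ℕ} (P : (Fin n → Fin q) → Prop) (i : ℕ) :
    IsClopen {x : ℕ → Fin q | P fun j => x (i + j)} :=
  (isClopen_discrete {w : Fin n → Fin q | P w}).preimage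
    (continuous_pi fun _ => continuous_apply _)

theorem appearsAt_iff {q n : ℕ} {w : Fin n → Fin q} {x : ℕ → Fin q} {i : ℕ} :
    AppearsAt w x i ↔ (fun j : Fin n => x (i + j)) = w :=
  funext_iff.symm

theorem appearsAt_shift_iterate {q n : ℕ} {w : Fin n → Fin q} {x : ℕ → Fin q} {m i : ℕ} :
    AppearsAt w (shift^[m] x) i ↔ AppearsAt w x (m + i) := by
  simp only [AppearsAt, shift_iterate_apply]
  refine forall_congr' fun j => ?_
  rw [show i + (j : ℕ) + m = m + i + j by omega]

theorem mapsTo_shift_avoidingShift {q n : ℕ} (F : Set (Fin n → Fin q)) :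
    MapsTo shift (avoidingShift F) (avoidingShift F) := by
  intro x hx w hw i h
  exact hx w hw (1 + i) (appearsAt_shift_iterate (m := 1).1 h)

/-- Compactness: if no `K` worked, the bad sequences for each `K` would form a decreasing chain of
nonempty compact sets. A common point avoids `F` everywhere, so it extends its own prefix, a
contradiction. -/
theorem exists_avoiding_extension {q n : ℕ} (F : Set (Fin n → Fin q)) :
    ∃ K : ℕ, ∀ x : ℕ → Fin q, (∀ i < K, ∀ w ∈ F, ¬ AppearsAt w x i) →
      ∃ y ∈ avoidingShift F, ∀ i < n, y i = x i := by
  by_contra! hcon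
  let t : ℕ → Set (ℕ → Fin q) := fun K =>
    {x | (∀ i < K, ∀ w ∈ F, ¬ AppearsAt w x i) ∧ ∀ y ∈ avoidingShift F, ∃ i < n, y i ≠ x i}
  have hclosed : ∀ K, IsClosed (t K) := by
    intro K
    have ht : t K = (⋂ i ∈ Iio K, {x : ℕ → Fin q | (fun j : Fin n => x (i + j)) ∉ F}) ∩
        {x : ℕ → Fin q | ∀ y ∈ avoidingShift F, ∃ i : Fin n, y i ≠ x (0 + i)} := by
      ext x
      simp only [t, Set.mem_inter_iff, Set.mem_iInter, Set.mem_ofPred_eq, appearsAt_iff, Set.mem_Iio,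
        zero_add]
      refine and_congr (forall₂_congr fun i _ => ?_) (forall₂_congr fun y _ => ?_)
      · exact ⟨fun h hF => h _ hF rfl, fun h w hw hx => h (hx ▸ hw)⟩
      · exact ⟨fun ⟨i, hi, h⟩ => ⟨⟨i, hi⟩, h⟩, fun ⟨i, h⟩ => ⟨i, i.2, h⟩⟩
    rw [ht]
    refine IsClosed.inter (isClosed_biInter fun i _ =>
      (isClopen_setOf_prefix (fun w => w ∉ F) i).isClosed) ?_
    exact (isClopen_setOf_prefix
      (fun w : Fin n → Fin q => ∀ y ∈ avoidingShift F, ∃ i : Fin n, y i ≠ w i) 0).isClosed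
  obtain ⟨x, hx⟩ := IsCompact.nonempty_iInter_of_sequence_nonempty_isCompact_isClosed t
    (fun K x hx => ⟨fun i hi => hx.1 i (by omega), hx.2⟩)
    (fun K => (hcon K).imp fun x hx => hx) (hclosed 0).isCompact hclosed
  rw [Set.mem_iInter] at hx
  have hxS : x ∈ avoidingShift F := fun w hw i => (hx (i + 1)).1 i (by omega) w hw
  obtain ⟨i, -, hi⟩ := (hx 0).2 x hxS
  exact hi rfl

theorem exists_forall_avoiding_extension {q n : ℕ} (F : Set (Fin n → Fin q)) :
    ∃ K : ℕ, ∀ (m : ℕ) (x : ℕ → Fin q), (∀ i < m + K, ∀ w ∈ F, ¬ AppearsAt w x i) →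
      ∃ y ∈ avoidingShift F, ∀ i < m + n, y i = x i := by
  obtain ⟨K, hK⟩ := exists_avoiding_extension F
  refine ⟨K, fun m x hx => ?_⟩
  obtain ⟨y, hy, hyx⟩ := hK (shift^[m] x) fun i hi w hw h =>
    hx (m + i) (by omega) w hw (appearsAt_shift_iterate.1 h)
  -- Glue at place `m`. A window of length `n` starting before `m` lies in the first `m + n` places,
  -- where `z` is `x`; a later one lies in `y`.
  let z : ℕ → Fin q := fun i => if i < m then x i else y (i - m)
  have hzx : ∀ i < m + n, z i = x i := by
    intro i hi
    by_cases him : i < m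
    · simp [z, him]
    · have := hyx (i - m) (by omega)
      rw [shift_iterate_apply, Nat.sub_add_cancel (by omega)] at this
      simp [z, him, this]
  refine ⟨z, fun w hw i h => ?_, hzx⟩
  by_cases him : i < m
  · refine hx i (by omega) w hw fun j => ?_
    rw [← hzx _ (by omega), h j]
  · refine hy w hw (i - m) fun j => ?_
    rw [← h j]
    simp only [z]
    rw [if_neg (by omega), show i + (j : ℕ) - m = i - m + j by omega]

/-- A word of length at least 2 that occurs in `Σ_M` begins with an allowed transition. -/
theorem avoidingShift_forbiddenWords {q : ℕ} (M : Matrix (Fin q) (Fin q) ℝ) {n : ℕ} (hn : 2 ≤ n) :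
    avoidingShift (forbiddenWords M n) = transitionShift M := by
  apply Set.Subset.antisymm
  · intro x hx i
    have h : (fun j : Fin n => x (i + j)) ∉ forbiddenWords M n := fun hw => hx _ hw i fun _ => rfl
    simp only [forbiddenWords, Set.mem_ofPred_eq, not_forall, not_not] at h
    obtain ⟨y, hy, k, hk⟩ := h
    have h0 := hk ⟨0, by omega⟩
    have h1 := hk ⟨1, by omega⟩
    simp only [add_zero] at h0 h1
    rw [← h0, ← h1]
    exact hy k
  · exact fun x hx w hw i => hw x hx i

/-! ### The Parry measure counts words -/

theorem measurableSet_cylinder {q n : ℕ} (M : Matrix (Fin q) (Fin q) ℝ) (w : Fin n → Fin q) :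
    MeasurableSet (cylinder M w) := by
  have : cylinder M w = ⋂ j : Fin n, {x : transitionShift M | x.1 (0 + j) = w j} := by
    ext x; simp [cylinder, AppearsAt]
  rw [this]
  refine MeasurableSet.iInter fun j => ?_
  exact measurableSet_eq_fun ((measurable_pi_apply (0 + (j : ℕ))).comp measurable_subtype_coe)
    measurable_const

theorem measure_eq_sum_cylinder {q m : ℕ} {M : Matrix (Fin q) (Fin q) ℝ}
    (μ : Measure (transitionShift M)) {A : Set (transitionShift M)}
    (hA : ∀ x y : transitionShift M, (∀ i < m, x.1 i = y.1 i) → x ∈ A → y ∈ A) :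
    μ A = ∑ w ∈ (Set.toFinite (prefixes (Subtype.val '' A) m)).toFinset, μ (cylinder M w) := by
  rw [← measure_biUnion_finset]
  · congr 1
    ext x
    simp only [Set.Finite.mem_toFinset, Set.mem_iUnion, exists_prop]
    constructor
    · intro hx
      exact ⟨_, ⟨x, ⟨x, hx, rfl⟩, rfl⟩, fun j => by rw [zero_add]⟩
    · rintro ⟨_, ⟨_, ⟨y, hy, rfl⟩, rfl⟩, hx⟩
      refine hA y x (fun i hi => ?_) hy
      have := hx ⟨i, hi⟩
      rw [zero_add] at this
      exact this.symm
  · intro w _ w' _ hww'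
    refine Set.disjoint_left.2 fun x hx hx' => hww' ?_
    exact funext fun j => (hx j).symm.trans (hx' j)
  · exact fun w _ => measurableSet_cylinder M w

theorem IsParryMeasure.measure_univ_le {q : ℕ} {M : Matrix (Fin q) (Fin q) ℝ}
    {μ : Measure (transitionShift M)} (hμ : IsParryMeasure M μ) : μ Set.univ ≤ 1 := by
  obtain ⟨l, u, v, hP, hcyl⟩ := hμ
  have hcover : (Set.univ : Set (transitionShift M)) ⊆
      ⋃ i ∈ (Finset.univ : Finset (Fin q)), cylinder M fun _ : Fin 1 => i :=
    fun x _ => Set.mem_iUnion₂.2 ⟨x.1 0, Finset.mem_univ _, fun j => by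
      rw [Fin.val_eq_zero j]⟩
  refine (measure_mono hcover).trans ((measure_biUnion_finset_le _ _).trans ?_)
  have h : ∀ i, μ (cylinder M fun _ : Fin 1 => i) = ENNReal.ofReal (u i * v i) := fun i => by
    simpa using hcyl 0 fun _ => i
  simp only [h]
  rw [← ENNReal.ofReal_sum_of_nonneg fun i _ =>
    (mul_pos (hP.left_pos i) (hP.right_pos i)).le]
  exact (congrArg ENNReal.ofReal hP.normalized).le.trans_eq ENNReal.ofReal_one

theorem IsParryMeasure.exists_bounds {q : ℕ} {M : Matrix (Fin q) (Fin q) ℝ}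
    {μ : Measure (transitionShift M)} (hμ : IsParryMeasure M μ)
    (hM : ∀ i j, 0 ≤ M i j) (hne : (transitionShift M).Nonempty) :
    ∃ c C l : ℝ, 0 < c ∧ 0 < C ∧ 0 < l ∧ ∀ (m : ℕ) (A : Set (transitionShift M)),
      (∀ x y : transitionShift M, (∀ i < m + 1, x.1 i = y.1 i) → x ∈ A → y ∈ A) →
      c * (wordCount (Subtype.val '' A) (m + 1) / l ^ m) ≤ μ.real A ∧
      μ.real A ≤ C * (wordCount (Subtype.val '' A) (m + 1) / l ^ m) := by
  obtain ⟨l, u, v, hP, hcyl⟩ := hμ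
  obtain ⟨x₀, hx₀⟩ := hne
  have : Nonempty (Fin q × Fin q) := ⟨(x₀ 0, x₀ 0)⟩
  -- The constants `c` and `C` are the extreme values of `u i * v j` over the finitely many pairs.
  obtain ⟨p, hp⟩ := Finite.exists_min fun p : Fin q × Fin q => u p.1 * v p.2
  obtain ⟨p', hp'⟩ := Finite.exists_max fun p : Fin q × Fin q => u p.1 * v p.2
  have hl : 0 < l := by
    have h := congrFun hP.left (x₀ 1)
    rw [Pi.smul_apply, smul_eq_mul] at h
    refine pos_of_mul_pos_left (b := u (x₀ 1)) (lt_of_lt_of_eq ?_ h) (hP.left_pos _).le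
    refine Finset.sum_pos' (fun i _ => mul_nonneg (hP.left_pos i).le (hM _ _))
      ⟨x₀ 0, Finset.mem_univ _, ?_⟩
    have h01 : M (x₀ 0) (x₀ 1) = 1 := hx₀ 0
    rw [h01, mul_one]
    exact hP.left_pos _
  refine ⟨u p.1 * v p.2, u p'.1 * v p'.2, l, mul_pos (hP.left_pos _) (hP.right_pos _),
    mul_pos (hP.left_pos _) (hP.right_pos _), hl, fun m A hA => ?_⟩
  have hreal : ∀ w ∈ (Set.toFinite (prefixes (Subtype.val '' A) (m + 1))).toFinset,
      μ (cylinder M w) = ENNReal.ofReal (u (w 0) * v (w (Fin.last m)) / l ^ m) := by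
    intro w hw
    rw [Set.Finite.mem_toFinset] at hw
    obtain ⟨_, ⟨x, -, rfl⟩, rfl⟩ := hw
    rw [hcyl, Finset.prod_eq_one, mul_one]
    exact fun i _ => x.2 i
  have hsum : μ.real A = ∑ w ∈ (Set.toFinite (prefixes (Subtype.val '' A) (m + 1))).toFinset,
      u (w 0) * v (w (Fin.last m)) / l ^ m := by
    have hn : ∀ w : Fin (m + 1) → Fin q, 0 ≤ u (w 0) * v (w (Fin.last m)) / l ^ m := fun w =>
      (div_pos (mul_pos (hP.left_pos _) (hP.right_pos _)) (pow_pos hl m)).le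
    rw [Measure.real, measure_eq_sum_cylinder μ hA, Finset.sum_congr rfl hreal,
      ← ENNReal.ofReal_sum_of_nonneg fun w _ => hn w,
      ENNReal.toReal_ofReal (Finset.sum_nonneg fun w _ => hn w)]
  have hcard : wordCount (Subtype.val '' A) (m + 1) =
      (Set.toFinite (prefixes (Subtype.val '' A) (m + 1))).toFinset.card :=
    Set.ncard_eq_toFinset_card _ _
  rw [hsum, hcard]
  constructor
  · rw [mul_div_left_comm, ← nsmul_eq_mul]
    refine Finset.card_nsmul_le_sum _ _ _ fun w _ => ?_
    exact div_le_div_of_nonneg_right (hp (w 0, w (Fin.last m))) (pow_pos hl m).le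
  · rw [mul_div_left_comm, ← nsmul_eq_mul]
    refine Finset.sum_le_card_nsmul _ _ _ fun w _ => ?_
    exact div_le_div_of_nonneg_right (hp' (w 0, w (Fin.last m))) (pow_pos hl m).le

theorem tendsto_log_div_of_bounds {a : ℕ → ℕ} {r : ℕ → ℝ} {c C l L : ℝ} {p : ℕ} (hc : 0 < c)
    (hC : 0 < C) (hl : 0 < l) (ha : ∀ m, 0 < a m)
    (hL : Tendsto (fun m : ℕ => Real.log (a m) / m) atTop (𝓝 L))
    (hr : ∀ᶠ m in atTop, c * (a (m + p + 1) / l ^ (m + p)) ≤ r m ∧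
      r m ≤ C * (a (m + p + 1) / l ^ (m + p))) :
    Tendsto (fun m : ℕ => Real.log (r m) / m) atTop (𝓝 (L - Real.log l)) := by
  have hlim : ∀ d : ℝ, 0 < d → Tendsto
      (fun m : ℕ => Real.log (d * (a (m + p + 1) / l ^ (m + p))) / m) atTop
      (𝓝 (L - Real.log l)) := by
    intro d hd
    have h1 := tendsto_div_shift (a := fun m => Real.log (a m)) hL (p + 1)
    have h2 := tendsto_const_div_atTop_nhds_zero_nat (Real.log d - p * Real.log l)
    have h3 := (h1.add h2).sub_const (Real.log l)
    rw [add_zero] at h3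
    refine h3.congr' ?_
    filter_upwards [eventually_gt_atTop 0] with m hm
    have hpos : (0 : ℝ) < a (m + p + 1) := by exact_mod_cast ha _
    have hlp : 0 < l ^ (m + p) := pow_pos hl _
    rw [Real.log_mul hd.ne' (by positivity), Real.log_div hpos.ne' hlp.ne', Real.log_pow]
    push_cast
    rw [← add_assoc]
    field_simp
    ring
  refine tendsto_of_tendsto_of_tendsto_of_le_of_le' (hlim c hc) (hlim C hC) ?_ ?_
  · filter_upwards [hr] with m hm
    have : (0 : ℝ) < a (m + p + 1) := by exact_mod_cast ha _
    gcongr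
    exact hm.1
  · filter_upwards [hr] with m hm
    have : (0 : ℝ) < a (m + p + 1) := by exact_mod_cast ha _
    have : 0 < r m := lt_of_lt_of_le (by positivity) hm.1
    gcongr
    exact hm.2

/-! ### Transfer along a metric conjugacy -/

theorem MetricConjugacy.iterate_comm {X₁ X₂ : Type*} [MeasurableSpace X₁] [MeasurableSpace X₂]
    {μ₁ : Measure X₁} {T₁ : X₁ → X₁} {μ₂ : Measure X₂} {T₂ : X₂ → X₂}
    (c : MetricConjugacy μ₁ T₁ μ₂ T₂) (x : c.A₂) (j : ℕ) :
    (c.ψ ((c.mapsTo₂.restrict T₂ _ _)^[j] x) : X₁) = T₁^[j] (c.ψ x) := by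
  induction j with
  | zero => rfl
  | succ j ih =>
    rw [Function.iterate_succ_apply', Function.iterate_succ_apply', ← ih]
    exact c.comm _

theorem measurePreserving_subtype_val {X : Type*} [MeasurableSpace X] {μ : Measure X}
    [IsProbabilityMeasure μ] {A : Set X} (hA : MeasurableSet A) (hfull : μ A = 1) :
    MeasurePreserving (Subtype.val : A → X) (μ.comap Subtype.val) μ := by
  refine ⟨measurable_subtype_coe, ?_⟩
  rw [map_comap_subtype_coe hA]
  exact Measure.restrict_eq_self_of_ae_mem ((mem_ae_iff_prob_eq_one hA).2 hfull)

/-- Corresponding sets have escape sets whose complements have the same measure. -/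
theorem MetricConjugacy.measure_compl_escaped {X₁ X₂ : Type*} [MeasurableSpace X₁]
    [MeasurableSpace X₂] {μ₁ : Measure X₁} {T₁ : X₁ → X₁} {μ₂ : Measure X₂} {T₂ : X₂ → X₂}
    [IsProbabilityMeasure μ₁] [IsProbabilityMeasure μ₂] (c : MetricConjugacy μ₁ T₁ μ₂ T₂)
    (hT₁ : MeasurePreserving T₁ μ₁ μ₁) {H : Set X₁} {E : Set X₂}
    (hcorr : c.Corresponds H E) (m : ℕ) :
    μ₁ (escaped T₁ H m)ᶜ = μ₂ (escaped T₂ E m)ᶜ := by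
  have hval₁ := measurePreserving_subtype_val c.measurableSet₁ c.full₁
  have hval₂ := measurePreserving_subtype_val c.measurableSet₂ c.full₂
  have hφ := hval₁.comp c.measurePreserving
  -- Preimages under measurable embeddings keep the measure even of nonmeasurable sets, such as
  -- possibly `N`.
  have hφe : MeasurableEmbedding (Subtype.val ∘ c.ψ) :=
    (MeasurableEmbedding.subtype_coe c.measurableSet₁).comp c.ψ.measurableEmbedding
  let R : c.A₂ → c.A₂ := c.mapsTo₂.restrict T₂ _ _
  have hR : ∀ (j : ℕ) (x : c.A₂), ((R^[j] x : c.A₂) : X₂) = T₂^[j] x := fun j x => by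
    rw [c.mapsTo₂.iterate_restrict]
    rfl
  let N : Set c.A₂ := {x | ¬ ((c.ψ x : X₁) ∈ H ↔ (x : X₂) ∈ E)}
  have hN : μ₂.comap Subtype.val N = 0 := by
    rw [measure_eq_zero_iff_ae_notMem]
    filter_upwards [hval₂.quasiMeasurePreserving.ae hcorr] with x hx
    exact not_not.2 (hx x.2)
  have himage : μ₁ ((Subtype.val ∘ c.ψ) '' N) = 0 := by
    rw [← hφ.measure_preimage_emb hφe, Set.preimage_image_eq _ hφe.injective, hN]
  -- Invariance of `μ₁` keeps the exceptional null set null along the orbit, so the correspondence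
  -- holds at all times simultaneously.
  have hNj : ∀ j : ℕ, ∀ᵐ x ∂μ₂.comap (Subtype.val : c.A₂ → X₂), R^[j] x ∉ N := by
    intro j
    have h := hφ.quasiMeasurePreserving.preimage_null
      ((hT₁.iterate j).quasiMeasurePreserving.preimage_null himage)
    refine measure_mono_null (fun x hx => ?_) h
    refine ⟨R^[j] x, not_not.1 hx, ?_⟩
    exact c.iterate_comm x j
  rw [← hφ.measure_preimage_emb hφe,
    ← hval₂.measure_preimage_emb (MeasurableEmbedding.subtype_coe c.measurableSet₂)]
  refine measure_congr ?_
  filter_upwards [ae_all_iff.2 hNj] with x hx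
  refine propext (not_congr (exists_congr fun j => and_congr_right fun _ => ?_))
  have := not_not.1 (hx j)
  rw [c.iterate_comm, hR] at this
  exact this

theorem mem_compl_escaped_iff {q n : ℕ} {M : Matrix (Fin q) (Fin q) ℝ} (F₁ : Set (Fin n → Fin q))
    (m : ℕ) (x : transitionShift M) :
    x ∈ (escaped (shiftOn M) (⋃ w ∈ F₁, cylinder M w) m)ᶜ ↔
      ∀ j ≤ m, ∀ w ∈ F₁, ¬ AppearsAt w x.1 j := by
  have hval : ∀ j, ((shiftOn M)^[j] x).1 = shift^[j] x.1 := fun j => by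
    induction j with
    | zero => rfl
    | succ j ih => rw [Function.iterate_succ_apply', Function.iterate_succ_apply', ← ih]; rfl
  simp only [escaped, cylinder, Set.mem_compl_iff, Set.mem_ofPred_eq, Set.mem_iUnion, not_exists,
    not_and, hval, appearsAt_shift_iterate, add_zero, exists_prop]

/-- The escape rate of the Parry measure through a union of cylinders. -/
theorem IsParryMeasure.hasEscapeRate {q n : ℕ} {M : Matrix (Fin q) (Fin q) ℝ}
    {μ : Measure (transitionShift M)} [IsProbabilityMeasure μ] (hμ : IsParryMeasure M μ)
    (hM : ∀ i j, 0 ≤ M i j) (hn : 2 ≤ n) (F₁ : Set (Fin n → Fin q)) :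
    HasEscapeRate μ (shiftOn M) (⋃ w ∈ F₁, cylinder M w)
      (topEntropy (avoidingShift (forbiddenWords M n)) -
        topEntropy (avoidingShift (forbiddenWords M n ∪ F₁))) := by
  have hne : (transitionShift M).Nonempty := by
    obtain ⟨x⟩ := nonempty_of_isProbabilityMeasure μ
    exact ⟨x.1, x.2⟩
  -- Windows starting at `j ≤ m` reach place `m + p`, so survival up to time `m` depends on `m + p +
  -- 1` letters.
  obtain ⟨p, rfl⟩ : ∃ p, n = p + 1 := ⟨n - 1, by omega⟩
  obtain ⟨c, C, l, hc, hC, hl, hbound⟩ := hμ.exists_bounds hM hne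
  have hentM : topEntropy (avoidingShift (forbiddenWords M (p + 1))) = (Real.log l : ℝ) := by
    rw [avoidingShift_forbiddenWords M hn]
    obtain ⟨L, hL⟩ := exists_tendsto_log_wordCount hne fun x hx i => hx (i + 1)
    rw [topEntropy_eq_of_tendsto hne hL]
    -- The total mass is constantly 1, so its rate `L - log l` must vanish.
    have h := tendsto_log_div_of_bounds (r := fun _ => 1) (p := 0) hc hC hl
      (wordCount_pos hne) hL (Eventually.of_forall fun m => by
        have h := hbound m Set.univ fun _ _ _ _ => Set.mem_univ _
        rwa [Set.image_univ, Subtype.range_coe, probReal_univ] at h)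
    simp only [Real.log_one, zero_div] at h
    have := tendsto_nhds_unique h tendsto_const_nhds
    rw [show L = Real.log l by linarith]
  rw [hentM]
  set E := ⋃ w ∈ F₁, cylinder M w with hE
  set S := avoidingShift (forbiddenWords M (p + 1) ∪ F₁) with hS
  have hSM : S ⊆ transitionShift M := by
    rw [← avoidingShift_forbiddenWords M hn]
    exact fun x hx w hw => hx w (Or.inl hw)
  obtain ⟨K, hK⟩ := exists_forall_avoiding_extension (forbiddenWords M (p + 1) ∪ F₁)
  have hext : ∀ m, ∀ x ∈ (escaped (shiftOn M) E (m + K))ᶜ,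
      ∃ y ∈ S, ∀ i < m + (p + 1), y i = x.1 i := by
    intro m x hx
    refine hK m x.1 fun i hi w hw => ?_
    rcases hw with hw | hw
    · exact hw x.1 x.2 i
    · exact (mem_compl_escaped_iff F₁ _ x).1 hx i hi.le w hw
  rcases S.eq_empty_or_nonempty with hempty | hSne
  · have htop : topEntropy S = ⊥ := by
      rw [hempty, topEntropy]
      let _ : UniformSpace (Fin q) := ⊥
      exact Dynamics.coverEntropy_empty
    rw [htop, EReal.coe_sub_bot]
    refine tendsto_const_nhds.congr' ?_
    -- Strict inequality also makes `m` positive, which `⊥ / m = ⊥` needs.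
    filter_upwards [eventually_gt_atTop K] with m hm
    have hesc : (escaped (shiftOn M) E m)ᶜ = ∅ := by
      refine Set.eq_empty_of_forall_notMem fun x hx => ?_
      rw [← Nat.sub_add_cancel hm.le] at hx
      obtain ⟨y, hy, -⟩ := hext (m - K) x hx
      rw [hempty] at hy
      exact hy
    rw [hesc, measure_empty, ENNReal.log_zero, EReal.bot_div_of_pos_ne_top, EReal.neg_bot]
    · exact_mod_cast (Nat.zero_le K).trans_lt hm
    · exact EReal.natCast_ne_top m
  · obtain ⟨L, hL⟩ := exists_tendsto_log_wordCount hSne (mapsTo_shift_avoidingShift _)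
    rw [topEntropy_eq_of_tendsto hSne hL, ← EReal.coe_sub]
    have hlower : ∀ m, wordCount S (m + p + 1) ≤
        wordCount (Subtype.val '' (escaped (shiftOn M) E m)ᶜ) (m + p + 1) := fun m =>
      wordCount_le_of_forall fun x hx => ⟨x, ⟨⟨x, hSM hx⟩,
        (mem_compl_escaped_iff F₁ m _).2 fun j _ w hw => hx w (Or.inr hw) j, rfl⟩, fun _ _ => rfl⟩
    have hupper : ∀ m, K ≤ m → wordCount (Subtype.val '' (escaped (shiftOn M) E m)ᶜ) (m + p + 1) ≤
        wordCount S (m + p + 1) * q ^ K := by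
      intro m hm
      obtain ⟨m, rfl⟩ := Nat.exists_eq_add_of_le' hm
      -- The last `K` letters are dropped at the cost of a factor `q ^ K`; the remaining `m + (p +
      -- 1)` extend to a sequence in `S`.
      rw [show m + K + p + 1 = m + (p + 1) + K by omega]
      refine (wordCount_add_le_mul_pow _ _ _).trans (Nat.mul_le_mul_right _ ?_)
      refine le_trans (wordCount_le_of_forall ?_) (wordCount_le_wordCount_add S _ K)
      rintro _ ⟨x, hx, rfl⟩
      exact hext m x hx
    have hdep : ∀ m (x y : transitionShift M), (∀ i < m + p + 1, x.1 i = y.1 i) →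
        x ∈ (escaped (shiftOn M) E m)ᶜ → y ∈ (escaped (shiftOn M) E m)ᶜ := by
      intro m x y hxy hx
      rw [mem_compl_escaped_iff] at hx ⊢
      refine fun j hj w hw h => hx j hj w hw fun i => ?_
      rw [hxy _ (by omega)]
      exact h i
    have hq : 0 < q := by
      obtain ⟨x, -⟩ := hne
      exact (x 0).pos
    have hlow : ∀ m, c * (wordCount S (m + p + 1) / l ^ (m + p)) ≤
        μ.real (escaped (shiftOn M) E m)ᶜ := by
      intro m
      refine le_trans ?_ (hbound (m + p) _ (hdep m)).1
      have := hlower m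
      gcongr
    have hpos : ∀ m, 0 < μ.real (escaped (shiftOn M) E m)ᶜ := by
      intro m
      have : (0 : ℝ) < wordCount S (m + p + 1) := by exact_mod_cast wordCount_pos hSne _
      exact lt_of_lt_of_le (by positivity) (hlow m)
    have hlim := tendsto_log_div_of_bounds (C := C * q ^ K) hc (by positivity) hl
      (wordCount_pos hSne) hL (p := p) (r := fun m => μ.real (escaped (shiftOn M) E m)ᶜ) (by
        filter_upwards [eventually_ge_atTop K] with m hm
        refine ⟨hlow m, (hbound (m + p) _ (hdep m)).2.trans ?_⟩
        have h : (wordCount (Subtype.val '' (escaped (shiftOn M) E m)ᶜ) (m + p + 1) : ℝ) ≤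
            wordCount S (m + p + 1) * q ^ K := by exact_mod_cast hupper m hm
        calc _ ≤ C * (wordCount S (m + p + 1) * q ^ K / l ^ (m + p)) := by gcongr
          _ = _ := by ring)
    have h := (continuous_coe_real_ereal.tendsto _).comp hlim.neg
    rw [neg_sub] at h
    refine h.congr fun m => ?_
    rw [ENNReal.log_pos_real' (hpos m)]
    simp only [Function.comp, EReal.coe_neg, EReal.coe_div]
    rfl

end EscapeRate

theorem mainTheorem4
    -- the product map `f₁ × ⋯ × f_k` on `I^k`, `I = [a, b]`, with an invariant probability measure
    {k : ℕ} {a b : ℝ} (f : Fin k → Set.Icc a b → Set.Icc a b)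
    (ν : MeasureTheory.Measure (Fin k → Set.Icc a b)) [MeasureTheory.IsProbabilityMeasure ν]
    (hf : MeasureTheory.MeasurePreserving (Pi.map f) ν ν)
    -- the subshift of finite type `Σ_M` with its Parry measure
    {q : ℕ} (M : Matrix (Fin q) (Fin q) ℝ) (hM : ∀ i j, M i j = 0 ∨ M i j = 1)
    (hirr : M.IsIrreducible)
    (μ : MeasureTheory.Measure (EscapeRate.transitionShift M))
    (hμ : EscapeRate.IsParryMeasure M μ)
    -- the two systems are metrically conjugate
    (π : EscapeRate.MetricConjugacy ν (Pi.map f) μ (EscapeRate.shiftOn M))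
    -- the hole `H` corresponds to the union of the cylinders of the words in `F₁`
    {n : ℕ} (hn : 2 ≤ n) (F₁ : Set (Fin n → Fin q))
    (H : Set (Fin k → Set.Icc a b)) (hH : MeasurableSet H)
    (hcorr : π.Corresponds H (⋃ w ∈ F₁, EscapeRate.cylinder M w)) :
    EscapeRate.HasEscapeRate ν (Pi.map f) H
      (EscapeRate.topEntropy (EscapeRate.avoidingShift (EscapeRate.forbiddenWords M n)) -
        EscapeRate.topEntropy
          (EscapeRate.avoidingShift (EscapeRate.forbiddenWords M n ∪ F₁))) := by
  have hprob : MeasureTheory.IsProbabilityMeasure μ :=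
    ⟨le_antisymm hμ.measure_univ_le (π.full₂ ▸ MeasureTheory.measure_mono (Set.subset_univ _))⟩
  have hM0 : ∀ i j, 0 ≤ M i j := fun i j => by
    rcases hM i j with h | h <;> simp [h]
  refine Filter.Tendsto.congr (fun m => ?_) (hμ.hasEscapeRate hM0 hn F₁)
  rw [π.measure_compl_escaped hf hcorr m]
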